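/- A \emph{weight} is a continuous, non-increasing function $v:[0,\infty)\to(0,\infty)$ with $\lim_{t\to\infty}t^kv(t)=0$ for all $k\ge 0$. It is \emph{normalized} if $v(t)=1$ for all $t\in[0,1]$, and \emph{convex} if $t\mapsto-\log v(e^t)$ is convex on $\mathbb{R}$. Let $H(\mathbb{C})$ be the algebra of entire functions and let $$H^\infty_v:=\Big\{f\in H(\mathbb{C}):\ \|f\|_v:=\sup_{z\in\mathbb{C}}|f(z)|\,v(|z|)<+\infty\Big\},$$ normed by $\|\cdot\|_v$. For $c>0$ put $v_c(t):=v(ct)$. For a weight $u$ consider the dilatation-type weight systems $\underline{\mathcal{U}}_{\mathfrak{c}}=(u_n)_{n\ge1}$ and $\overline{\mathcal{U}}_{\mathfrak{c}}=(u_{1/n})_{n\ge1}$, $n\in\mathbb{N}_{>0}$, and the corresponding (LB)-space and Fréchet space $$H^\infty_{\underline{\mathcal{U}}_{\mathfrak{c}}}:=\varinjlim_{n}H^\infty_{u_n}=\bigcup_{n\ge1}H^\infty_{u_n},\qquad H^\infty_{\overline{\mathcal{U}}_{\mathfrak{c}}}:=\varprojlim_{n}H^\infty_{u_{1/n}}=\bigcap_{n\ge1}H^\infty_{u_{1/n}},$$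 the first with the finest locally convex topology making all inclusions of the $H^\infty_{u_n}$ continuous, the second with the coarsest topology making all inclusions into the $H^\infty_{u_{1/n}}$ continuous. Finally let $M^u_j:=\sup_{t>0}t^ju(t)$ for $j\in\mathbb{N}=\{0,1,2,\dots\}$. \textbf{Theorem.} Let $u$ be a normalized and convex weight. Then the following are equivalent: \begin{itemize} \item[(i)] $H^\infty_{\underline{\mathcal{U}}_{\mathfrak{c}}}$ is closed under pointwise multiplication and the bilinear operator $\mathfrak{m}:(f,g)\mapsto f\cdot g$ is continuous from $H^\infty_{\underline{\mathcal{U}}_{\mathfrak{c}}}\times H^\infty_{\underline{\mathcal{U}}_{\mathfrak{c}}}$ (with the product topology) to $H^\infty_{\underline{\mathcal{U}}_{\mathfrak{c}}}$. \item[(ii)] $H^\infty_{\overline{\mathcal{U}}_{\mathfrak{c}}}$ is closed under pointwise multiplication and $\mathfrak{m}$ is continuous from $H^\infty_{\overline{\mathcal{U}}_{\mathfrak{c}}}\times H^\infty_{\overline{\mathcal{U}}_{\mathfrak{c}}}$ (with the product topology) to $H^\infty_{\overline{\mathcal{U}}_{\mathfrak{c}}}$. \item[(iii)] $u$ is of moderate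 growth: there is $H\ge1$ such that $u(Ht)\le e^{H}u(t)^2$ for all $t\ge0$. \item[(iv)] The associated sequence $M^u$ satisfies (mg): there is $C\ge1$ such that $M^u_{j+k}\le C^{j+k}M^u_jM^u_k$ for all $j,k\in\mathbb{N}$. \end{itemize} -/

import Mathlib

open scoped NNReal

noncomputable section

namespace WeightedEntire

/-! ### Weight functions -/

/-- A (radial) weight function `v : [0, ∞) → (0, ∞)`: continuous, non-increasing and
rapidly decreasing. -/
structure Weight where
  toFun : ℝ≥0 → ℝ
  pos' : ∀ t, 0 < toFun t
  continuous' : Continuous toFun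
  antitone' : Antitone toFun
  rapid' : ∀ k : ℕ, Filter.Tendsto (fun t : ℝ≥0 => (t : ℝ) ^ k * toFun t) Filter.atTop (nhds 0)

namespace Weight

instance : CoeFun Weight (fun _ => ℝ≥0 → ℝ) := ⟨Weight.toFun⟩

/-- Weights are ordered pointwise. -/
instance : LE Weight := ⟨fun v w => ∀ t, v t ≤ w t⟩

/-- `v` is normalized: `v(t) = 1` for `t ∈ [0, 1]`. -/
def IsNormalized (v : Weight) : Prop := ∀ t : ℝ≥0, t ≤ 1 → v t = 1

/-- `ω^v(t) = -log v(t)`. -/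
def omega (v : Weight) (t : ℝ≥0) : ℝ := -Real.log (v t)

/-- `v` is convex: `t ↦ ω^v(e^t) = -log v(e^t)` is convex on `ℝ`. -/
def IsConvex (v : Weight) : Prop :=
  ConvexOn ℝ Set.univ (fun t : ℝ => v.omega ⟨Real.exp t, (Real.exp_pos t).le⟩)

/-- `v` is of moderate growth: there is `H ≥ 1` with `v(H t) ≤ e^H v(t)^2` for all `t ≥ 0`. -/
def IsModerateGrowth (v : Weight) : Prop :=
  ∃ H : ℝ≥0, 1 ≤ H ∧ ∀ t : ℝ≥0, v (H * t) ≤ Real.exp H * v t ^ 2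

/-- The dilated weight `v_c : t ↦ v(c t)`, for `c > 0`. -/
def dilate (v : Weight) (c : ℝ≥0) (hc : 0 < c) : Weight where
  toFun t := v (c * t)
  pos' t := v.pos' _
  continuous' := v.continuous'.comp (continuous_const.mul continuous_id)
  antitone' s t h := v.antitone' (mul_le_mul_right h c)
  rapid' k := by
    have h1 : Filter.Tendsto (fun t : ℝ≥0 => c * t) Filter.atTop Filter.atTop :=
      Filter.Tendsto.const_mul_atTop hc Filter.tendsto_id
    have h2 := ((v.rapid' k).comp h1).const_mul (((c : ℝ) ^ k)⁻¹)
    rw [mul_zero] at h2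
    refine h2.congr fun t => ?_
    have hc' : (c : ℝ) ^ k ≠ 0 := pow_ne_zero _ (NNReal.coe_ne_zero.mpr hc.ne')
    simp only [Function.comp, NNReal.coe_mul, mul_pow]
    field_simp

/-- The non-increasing dilatation-type system `(v_c)_{c = 1, 2, …}`. -/
def lowerSystem (v : Weight) (c : ℕ+) : Weight :=
  v.dilate (c : ℕ) (by exact_mod_cast c.pos)

/-- The non-decreasing dilatation-type system `(v_{1/c})_{c = 1, 2, …}`. -/
def upperSystem (v : Weight) (c : ℕ+) : Weight :=
  v.dilate (1 / (c : ℕ)) (one_div_pos.mpr (by exact_mod_cast c.pos))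

/-- The associated sequence `M^v_j = sup_{t > 0} t^j v(t)`. -/
def assocSeq (v : Weight) (j : ℕ) : ℝ :=
  sSup ((fun t : ℝ≥0 => (t : ℝ) ^ j * v t) '' Set.Ioi 0)

/-- The suprema defining the associated sequence are finite. -/
theorem bddAbove_assocSeq (v : Weight) (j : ℕ) :
    BddAbove ((fun t : ℝ≥0 => (t : ℝ) ^ j * v t) '' Set.Ioi 0) := by
  obtain ⟨T, hT⟩ := Filter.eventually_atTop.mp ((v.rapid' j).eventually_le_const one_pos)
  refine ⟨max 1 ((T : ℝ) ^ j * v 0), ?_⟩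
  rintro _ ⟨t, -, rfl⟩
  rcases le_total T t with h | h
  · exact (hT t h).trans (le_max_left _ _)
  · refine le_trans ?_ (le_max_right _ _)
    have h0 : v t ≤ v 0 := v.antitone' (zero_le (a := t))
    have h1 : (t : ℝ) ^ j ≤ (T : ℝ) ^ j :=
      pow_le_pow_left₀ t.coe_nonneg (NNReal.coe_le_coe.mpr h) j
    exact mul_le_mul h1 h0 (v.pos' t).le (by positivity)

end Weight

/-- Condition (mg) for a sequence: there is `C ≥ 1` with
`M_{j+k} ≤ C^{j+k} M_j M_k` for all `j, k`. -/
def SeqModerateGrowth (M : ℕ → ℝ) : Prop :=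
  ∃ C : ℝ, 1 ≤ C ∧ ∀ j k : ℕ, M (j + k) ≤ C ^ (j + k) * (M j * M k)

/-! ### Entire functions and weighted spaces -/

/-- The entire functions, as a subalgebra of all functions `ℂ → ℂ` (pointwise operations). -/
def entireSubalgebra : Subalgebra ℂ (ℂ → ℂ) where
  carrier := {f | Differentiable ℂ f}
  mul_mem' hf hg := Differentiable.mul hf hg
  add_mem' hf hg := Differentiable.add hf hg
  algebraMap_mem' c := differentiable_const c

/-- The algebra `H(ℂ)` of entire functions. It is a type synonym so that it carries no topology:
all topologies used below are put explicitly on the weighted spaces. -/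
def Entire : Type := ↥entireSubalgebra

instance : CommRing Entire := inferInstanceAs (CommRing ↥entireSubalgebra)
instance : Algebra ℂ Entire := inferInstanceAs (Algebra ℂ ↥entireSubalgebra)
instance : CoeFun Entire (fun _ => ℂ → ℂ) := ⟨fun f => f.1⟩

namespace Entire

theorem differentiable (f : Entire) : Differentiable ℂ (f : ℂ → ℂ) := f.2

@[ext] theorem ext {f g : Entire} (h : ∀ z, f z = g z) : f = g := Subtype.ext (funext h)

@[simp] theorem zero_apply (z : ℂ) : (0 : Entire) z = 0 := rfl
@[simp] theorem add_apply (f g : Entire) (z : ℂ) : (f + g) z = f z + g z := rfl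
@[simp] theorem mul_apply (f g : Entire) (z : ℂ) : (f * g) z = f z * g z := rfl
@[simp] theorem smul_apply (c : ℂ) (f : Entire) (z : ℂ) : (c • f) z = c * f z := rfl

end Entire

/-- The space `H^∞_v = {f ∈ H(ℂ) : sup_z |f(z)| v(|z|) < ∞}`. -/
def HInf (v : Weight) : Submodule ℂ Entire where
  carrier := {f | BddAbove (Set.range fun z : ℂ => ‖f z‖ * v ‖z‖₊)}
  zero_mem' := ⟨0, by rintro _ ⟨z, rfl⟩; simp⟩
  add_mem' := by
    rintro f g ⟨A, hA⟩ ⟨B, hB⟩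
    refine ⟨A + B, ?_⟩
    rintro _ ⟨z, rfl⟩
    have h1 : ‖f z‖ * v ‖z‖₊ ≤ A := hA ⟨z, rfl⟩
    have h2 : ‖g z‖ * v ‖z‖₊ ≤ B := hB ⟨z, rfl⟩
    have h3 := mul_le_mul_of_nonneg_right (norm_add_le (f z) (g z)) (v.pos' ‖z‖₊).le
    simp only [Entire.add_apply]
    linarith
  smul_mem' := by
    rintro c f ⟨A, hA⟩
    refine ⟨‖c‖ * A, ?_⟩
    rintro _ ⟨z, rfl⟩
    have h1 : ‖f z‖ * v ‖z‖₊ ≤ A := hA ⟨z, rfl⟩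
    simp only [Entire.smul_apply, norm_mul, mul_assoc]
    exact mul_le_mul_of_nonneg_left h1 (norm_nonneg c)

/-- The norm `‖f‖_v = sup_z |f(z)| v(|z|)` on `H^∞_v`. -/
instance (v : Weight) : Norm (HInf v) := ⟨fun f => ⨆ z : ℂ, ‖f.1 z‖ * v ‖z‖₊⟩

theorem HInf.norm_def {v : Weight} (f : HInf v) : ‖f‖ = ⨆ z : ℂ, ‖f.1 z‖ * v ‖z‖₊ := rfl

theorem HInf.le_norm {v : Weight} (f : HInf v) (z : ℂ) : ‖f.1 z‖ * v ‖z‖₊ ≤ ‖f‖ :=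
  le_ciSup f.2 z

/-- `‖·‖_v` is a norm. -/
theorem HInf.normCore (v : Weight) : NormedSpace.Core ℂ (HInf v) where
  norm_nonneg f := Real.iSup_nonneg fun z => mul_nonneg (norm_nonneg _) (v.pos' _).le
  norm_smul c f := by
    rw [HInf.norm_def, HInf.norm_def, Real.mul_iSup_of_nonneg (norm_nonneg c)]
    refine iSup_congr fun z => ?_
    change ‖c * f.1 z‖ * _ = _
    rw [norm_mul, mul_assoc]
  norm_triangle f g := by
    refine ciSup_le fun z => ?_
    have h1 := HInf.le_norm f z
    have h2 := HInf.le_norm g z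
    have h3 := mul_le_mul_of_nonneg_right (norm_add_le (f.1 z) (g.1 z)) (v.pos' ‖z‖₊).le
    change ‖f.1 z + g.1 z‖ * _ ≤ _
    linarith
  norm_eq_zero_iff f := by
    constructor
    · intro h
      refine Subtype.ext (Entire.ext fun z => ?_)
      have h1 := HInf.le_norm f z
      rw [h] at h1
      have h2 : ‖f.1 z‖ ≤ 0 := nonpos_of_mul_nonpos_left h1 (v.pos' _)
      exact norm_le_zero_iff.mp h2
    · rintro rfl
      simp [HInf.norm_def]

instance (v : Weight) : NormedAddCommGroup (HInf v) := NormedAddCommGroup.ofCore (HInf.normCore v)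
instance (v : Weight) : NormedSpace ℂ (HInf v) := NormedSpace.ofCore (HInf.normCore v)

/-! ### Inductive and projective limits of weighted spaces -/

/-- The vector space underlying the inductive limit of the spaces `H^∞_{V n}`. For a
non-increasing system of weights this is the union of these spaces (`mem_indLim`). -/
def indLim (V : ℕ+ → Weight) : Submodule ℂ Entire := ⨆ n, HInf (V n)

/-- The inclusion `H^∞_{V n} → indLim V`. -/
def toIndLim (V : ℕ+ → Weight) (n : ℕ+) : HInf (V n) →ₗ[ℂ] indLim V :=
  Submodule.inclusion (le_iSup (fun n => HInf (V n)) n)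

/-- The locally convex inductive limit topology: the finest locally convex vector space topology
for which all the inclusions `H^∞_{V n} → indLim V` are continuous. -/
instance (V : ℕ+ → Weight) : TopologicalSpace (indLim V) :=
  sInf {t : TopologicalSpace (indLim V) |
    @IsTopologicalAddGroup (indLim V) t _ ∧ @ContinuousSMul ℂ (indLim V) _ _ t ∧
    @LocallyConvexSpace ℝ (indLim V) _ _ _ _ t ∧
    ∀ n, @Continuous (HInf (V n)) (indLim V) _ t (toIndLim V n)}

/-- The vector space underlying the projective limit of the spaces `H^∞_{V n}`: their
intersection. -/
def projLim (V : ℕ+ → Weight) : Submodule ℂ Entire := ⨅ n, HInf (V n)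

/-- The inclusion `projLim V → H^∞_{V n}`. -/
def ofProjLim (V : ℕ+ → Weight) (n : ℕ+) : projLim V →ₗ[ℂ] HInf (V n) :=
  Submodule.inclusion (iInf_le (fun n => HInf (V n)) n)

/-- The projective limit topology: the coarsest topology for which all the inclusions
`projLim V → H^∞_{V n}` are continuous. -/
instance (V : ℕ+ → Weight) : TopologicalSpace (projLim V) :=
  ⨅ n, TopologicalSpace.induced (ofProjLim V n) inferInstance

theorem mem_projLim {V : ℕ+ → Weight} {f : Entire} : f ∈ projLim V ↔ ∀ n, f ∈ HInf (V n) :=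
  Submodule.mem_iInf _

theorem HInf_mono {v w : Weight} (h : w ≤ v) : HInf v ≤ HInf w := by
  rintro f ⟨A, hA⟩
  refine ⟨A, ?_⟩
  rintro _ ⟨z, rfl⟩
  exact (mul_le_mul_of_nonneg_left (h _) (norm_nonneg _)).trans (hA ⟨z, rfl⟩)

theorem mem_indLim {V : ℕ+ → Weight} (hV : ∀ m n, m ≤ n → V n ≤ V m) {f : Entire} :
    f ∈ indLim V ↔ ∃ n, f ∈ HInf (V n) :=
  Submodule.mem_iSup_of_directed _
    (Monotone.directed_le fun m n h => HInf_mono (hV m n h))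

theorem Weight.lowerSystem_antitone (v : Weight) (m n : ℕ+) (h : m ≤ n) :
    v.lowerSystem n ≤ v.lowerSystem m := fun t =>
  v.antitone' (mul_le_mul_left (Nat.cast_le.mpr (PNat.coe_le_coe _ _ |>.mpr h)) t)

/-- A topologized space `E` of entire functions is closed under pointwise multiplication and the
(bilinear) multiplication operator `E × E → E`, `(f, g) ↦ f · g`, is continuous. -/
def MulActsContinuously (E : Submodule ℂ Entire) [TopologicalSpace E] : Prop :=
  ∃ h : ∀ f ∈ E, ∀ g ∈ E, f * g ∈ E,
    Continuous (fun p : E × E => (⟨p.1.1 * p.2.1, h p.1.1 p.1.2 p.2.1 p.2.2⟩ : E))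

end WeightedEntire

end

namespace WeightedEntire

/-! ### Moderate growth of a weight and of its associated sequence -/

namespace Weight

variable {u : Weight}

/-! Everything rests on comparing `1/u(t)` with `sup_j t^j / M_j`. The bound `t^j / M_j ≤ 1/u(t)` is
immediate. Conversely, convexity and normalization provide, for every `t ≥ 1`, an index `j` with
`t^j / M_j ≥ 1/(t u(t))` (`IsConvex.exists_assocSeq_le`). The lost factor `t` is harmless: an
inequality `u(ct) ≤ A t² u(t)²` for `t ≥ 1` already implies moderate growth, because `u` decays
rapidly (`IsNormalized.isModerateGrowth_of_le`). This yields (iii) ⇔ (iv).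

Moderate growth means that, after a fixed dilatation, the weight is dominated by a multiple of its
own square, so a product of two functions from one step lies in a dilated step with a norm estimate.
For the projective limit this gives continuity at once. For the inductive limit, neighbourhoods of
zero must be built from balls in all steps (`continuous_bilinear_of_finest`).

Conversely, the function `F(z) = ∑ z^j / (2^j M_j)` lies in `H^∞_u`, and `F(2t) ≥ t^j / M_j` for
every `j`. If `F²` lies in some step `n`, then `u(2nt) ≤ A t² u(t)²`, whence (i) ⇒ (iii). For (ii) ⇒
(iv), continuity at zero is tested on scaled monomials, whose norms are given by the `M_j`. -/

theorem pow_mul_le_assocSeq (u : Weight) (j : ℕ) (t : ℝ≥0) :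
    (t : ℝ) ^ j * u t ≤ u.assocSeq j := by
  have h : ∀ s ∈ Set.Ioi (0 : ℝ≥0), (s : ℝ) ^ j * u s ≤ u.assocSeq j :=
    fun s hs => le_csSup (u.bddAbove_assocSeq j) ⟨s, hs, rfl⟩
  -- The supremum ranges over `t > 0` only; the case `t = 0` follows by continuity.
  have hcl : IsClosed {s : ℝ≥0 | (s : ℝ) ^ j * u s ≤ u.assocSeq j} :=
    isClosed_le ((NNReal.continuous_coe.pow j).mul u.continuous') continuous_const
  have := hcl.closure_subset_iff.mpr h
  rw [closure_Ioi] at this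
  exact this (zero_le (a := t))

theorem assocSeq_le (u : Weight) {j : ℕ} {a : ℝ} (h : ∀ t : ℝ≥0, 0 < t → (t : ℝ) ^ j * u t ≤ a) :
    u.assocSeq j ≤ a :=
  csSup_le (Set.Nonempty.image _ ⟨1, Set.mem_Ioi.mpr one_pos⟩) (by rintro _ ⟨t, ht, rfl⟩; exact h t ht)

theorem IsNormalized.le_one (hn : u.IsNormalized) (t : ℝ≥0) : u t ≤ 1 :=
  (u.antitone' (zero_le (a := t))).trans_eq (hn 0 zero_le_one)

theorem IsNormalized.one_le_assocSeq (hn : u.IsNormalized) (j : ℕ) : 1 ≤ u.assocSeq j := by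
  have h := u.pow_mul_le_assocSeq j 1
  rwa [hn 1 le_rfl, NNReal.coe_one, one_pow, one_mul] at h

theorem IsNormalized.assocSeq_zero (hn : u.IsNormalized) : u.assocSeq 0 = 1 :=
  le_antisymm (u.assocSeq_le fun t _ => by simpa using hn.le_one t) (hn.one_le_assocSeq 0)

/-- The weight in exponential form. -/
theorem apply_eq_exp_neg (u : Weight) {t : ℝ≥0} (ht : 0 < t) :
    u t = Real.exp (-u.omega ⟨Real.exp (Real.log t), (Real.exp_pos _).le⟩) := by
  have : (⟨Real.exp (Real.log t), (Real.exp_pos _).le⟩ : ℝ≥0) = t :=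
    NNReal.eq (Real.exp_log (NNReal.coe_pos.mpr ht))
  rw [this, omega, neg_neg, Real.exp_log (u.pos' t)]

/-- A convex function on the real line has a supporting line at every point. -/
theorem _root_.ConvexOn.exists_supporting_line {f : ℝ → ℝ} (hf : ConvexOn ℝ Set.univ f) (x : ℝ) :
    ∃ r : ℝ, ∀ y, f x + r * (y - x) ≤ f y := by
  have hx : x ∈ interior (Set.univ : Set ℝ) := by simp
  refine ⟨derivWithin f (Set.Ioi x) x, fun y => ?_⟩
  rcases lt_trichotomy y x with h | rfl | h
  · have h1 := (hf.slope_le_leftDeriv_of_mem_interior (Set.mem_univ y) hx h).trans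
      (hf.leftDeriv_le_rightDeriv_of_mem_interior hx)
    rw [slope_def_field, div_le_iff₀ (by linarith)] at h1
    linarith
  · simp
  · have h1 := hf.rightDeriv_le_slope_of_mem_interior hx (Set.mem_univ y) h
    rw [slope_def_field, le_div_iff₀ (by linarith)] at h1
    linarith

/-- A normalized convex weight is recovered from its associated sequence, up to a factor `t`. -/
theorem IsConvex.exists_assocSeq_le (hn : u.IsNormalized) (hc : u.IsConvex) {t : ℝ≥0}
    (ht : 1 ≤ t) : ∃ j : ℕ, u.assocSeq j ≤ (t : ℝ) ^ (j + 1) * u t := by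
  set φ : ℝ → ℝ := fun s => u.omega ⟨Real.exp s, (Real.exp_pos s).le⟩ with hφ
  have hexp : ∀ x : ℝ≥0, 0 < x → u x = Real.exp (-φ (Real.log x)) :=
    fun x hx => u.apply_eq_exp_neg hx
  have ht0 : 0 < t := one_pos.trans_le ht
  set s := Real.log t with hs
  have hs0 : 0 ≤ s := Real.log_nonneg (by exact_mod_cast ht)
  have hmono : ∀ x y, x ≤ y → φ x ≤ φ y := fun x y h => by
    refine neg_le_neg (Real.log_le_log (u.pos' _) (u.antitone' ?_))
    exact NNReal.coe_le_coe.mp (Real.exp_le_exp.mpr h)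
  have hzero : ∀ x, x ≤ 0 → φ x = 0 := fun x hx => by
    have : u ⟨Real.exp x, (Real.exp_pos x).le⟩ = 1 :=
      hn _ (NNReal.coe_le_coe.mp (Real.exp_le_one_iff.mpr hx))
    simp [hφ, omega, this]
  obtain ⟨r, hr⟩ := ConvexOn.exists_supporting_line hc s
  change ∀ y, φ s + r * (y - s) ≤ φ y at hr
  have hr0 : 0 ≤ r := by
    have h1 := hr (s - 1)
    have h2 := hmono (s - 1) s (by linarith)
    linarith
  -- The slope `r` is the exponent for which `x ↦ r x - φ x` is maximal at `s`; an integer exponent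
  -- is needed, so it is rounded down.
  set j := ⌊r⌋₊ with hj
  have hj1 : (j : ℝ) ≤ r := Nat.floor_le hr0
  have hj2 : r < j + 1 := Nat.lt_floor_add_one r
  -- By the supporting line, `j x - φ x ≤ j s - φ s + (r - j)(s - x)`. Since `0 ≤ r - j < 1` and `x
  -- ≥ 0`, rounding costs at most `s = log t`, that is, one factor `t`.
  have hpos : ∀ x, 0 ≤ x → j * x - φ x ≤ (j + 1) * s - φ s := fun x hx => by
    have h1 := hr x
    rcases le_total s x with h | h
    · nlinarith
    · nlinarith
  have key : ∀ x, j * x - φ x ≤ (j + 1) * s - φ s := fun x => by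
    rcases le_total 0 x with h | h
    · exact hpos x h
    · have h1 := hpos 0 le_rfl
      rw [hzero 0 le_rfl] at h1
      rw [hzero x h]
      have : (j : ℝ) * x ≤ 0 := mul_nonpos_of_nonneg_of_nonpos (Nat.cast_nonneg j) h
      linarith
  have hpow : ∀ (k : ℕ) (x : ℝ≥0), 0 < x →
      (x : ℝ) ^ k * u x = Real.exp (k * Real.log x - φ (Real.log x)) := fun k x hx => by
    rw [hexp x hx, sub_eq_add_neg, Real.exp_add, Real.exp_nat_mul,
      Real.exp_log (NNReal.coe_pos.mpr hx)]
  have hpow1 : (t : ℝ) ^ (j + 1) * u t = Real.exp ((j + 1) * s - φ s) := by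
    rw [hpow _ t ht0]; push_cast; rfl
  refine ⟨j, u.assocSeq_le fun x hx => ?_⟩
  rw [hpow1, hpow j x hx]
  exact Real.exp_le_exp.mpr (key _)

/-- Moderate growth is insensitive to a quadratic factor. -/
theorem IsNormalized.isModerateGrowth_of_le (hn : u.IsNormalized) (c : ℝ≥0) (A : ℝ)
    (h : ∀ t : ℝ≥0, 1 ≤ t → u (c * t) ≤ A * t ^ 2 * u t ^ 2) : u.IsModerateGrowth := by
  -- One of the four factors `u t` in the square of the hypothesis absorbs `A² t⁴`, leaving `u(c't)
  -- ≤ u(t)^(3/2)` for large `t`.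
  have hlim := (u.rapid' 4).const_mul (A ^ 2)
  rw [mul_zero] at hlim
  obtain ⟨T, hT⟩ := Filter.eventually_atTop.mp (hlim.eventually_le_const one_pos)
  set c' := max c 1 with hc'
  set T' := max T 1
  have hcube : ∀ t, T' ≤ t → u (c' * t) ^ 2 ≤ u t ^ 3 := fun t ht => by
    have h1 := (u.antitone' (mul_le_mul_left (le_max_left c 1) t)).trans
      (h t ((le_max_right _ _).trans ht))
    have h2 := hT t ((le_max_left _ _).trans ht)
    have h3 := pow_le_pow_left₀ (u.pos' _).le h1 2
    have h4 := mul_le_mul_of_nonneg_right h2 (pow_nonneg (u.pos' t).le 3)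
    calc _ ≤ _ := h3
      _ = A ^ 2 * (t ^ 4 * u t) * u t ^ 3 := by ring
      _ ≤ _ := by simpa using h4
  -- Two dilatations give the exponent `(3/2)² = 9/4 ≥ 2`, and `u ≤ 1`. Fourth powers avoid
  -- fractional exponents.
  have hsq : ∀ t, T' ≤ t → u (c' * (c' * t)) ≤ u t ^ 2 := fun t ht => by
    have h1 := hcube t ht
    have h2 := hcube (c' * t) (ht.trans (le_mul_of_one_le_left' (le_max_right c 1)))
    refine le_of_pow_le_pow_left₀ (n := 4) (by norm_num) (by have := u.pos' t; positivity) ?_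
    calc u (c' * (c' * t)) ^ 4 = (u (c' * (c' * t)) ^ 2) ^ 2 := by ring
      _ ≤ (u (c' * t) ^ 3) ^ 2 := pow_le_pow_left₀ (by positivity) h2 2
      _ = (u (c' * t) ^ 2) ^ 3 := by ring
      _ ≤ (u t ^ 3) ^ 3 := pow_le_pow_left₀ (by positivity) h1 3
      _ = u t ^ 9 := by ring
      _ ≤ u t ^ 8 := pow_le_pow_of_le_one (u.pos' t).le (hn.le_one t) (by norm_num)
      _ = (u t ^ 2) ^ 4 := by ring
  have hT0 := u.pos' T'
  -- The second entry handles `t ≤ T'`, where `u(t)²` is bounded below by `u(T')²` and `H ≤ e^H`.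
  set H : ℝ≥0 := max (c' * c') ⟨(u T' ^ 2)⁻¹, by positivity⟩
  have hH1 : c' * c' ≤ H := le_max_left _ _
  have hH2 : (u T' ^ 2)⁻¹ ≤ (H : ℝ) := NNReal.coe_le_coe.mpr (le_max_right (c' * c') ⟨_, _⟩)
  have hexp : (H : ℝ) ≤ Real.exp H := by linarith [Real.add_one_le_exp (H : ℝ)]
  refine ⟨H, (one_le_mul (le_max_right c 1) (le_max_right c 1)).trans hH1, fun t => ?_⟩
  rcases le_total T' t with ht | ht
  · calc u (H * t) ≤ u (c' * (c' * t)) := u.antitone' (by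
          rw [← mul_assoc]; exact mul_le_mul_left hH1 t)
      _ ≤ u t ^ 2 := hsq t ht
      _ ≤ _ := le_mul_of_one_le_left (by positivity) (Real.one_le_exp H.coe_nonneg)
  · calc u (H * t) ≤ 1 := hn.le_one _
      _ = (u T' ^ 2)⁻¹ * u T' ^ 2 := by field_simp
      _ ≤ Real.exp H * u t ^ 2 := mul_le_mul (hH2.trans hexp)
          (pow_le_pow_left₀ hT0.le (u.antitone' ht) 2) (by positivity) (by positivity)

/-- With `j` chosen for `t`, one has `(Ct)^(2j) u(Ct) ≤ M_{2j} ≤ C^(2j) M_j² ≤ C^(2j) (t^(j+1)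
u(t))²`. Cancelling `(Ct)^(2j)` leaves `u(Ct) ≤ t² u(t)²`. -/
theorem IsConvex.isModerateGrowth_of_assocSeq (hn : u.IsNormalized) (hc : u.IsConvex)
    (h : SeqModerateGrowth u.assocSeq) : u.IsModerateGrowth := by
  obtain ⟨C, hC, h⟩ := h
  have hC0 : 0 < C := one_pos.trans_le hC
  lift C to ℝ≥0 using hC0.le
  refine hn.isModerateGrowth_of_le C 1 fun t ht => ?_
  have ht0 : 0 < (t : ℝ) := by exact_mod_cast one_pos.trans_le ht
  obtain ⟨j, hj⟩ := hc.exists_assocSeq_le hn ht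
  have h1 := (u.pow_mul_le_assocSeq (j + j) (C * t)).trans (h j j)
  have hM := zero_le_one.trans (hn.one_le_assocSeq j)
  have h2 := mul_le_mul hj hj hM (hM.trans hj)
  have h3 := h1.trans (mul_le_mul_of_nonneg_left h2 (by positivity))
  rw [NNReal.coe_mul, mul_pow, mul_assoc,
    mul_le_mul_iff_right₀ (by positivity)] at h3
  refine le_of_mul_le_mul_left (h3.trans_eq ?_) (pow_pos ht0 (j + j))
  ring

/-- In condition (mg), an additional constant factor is harmless. -/
theorem IsNormalized.seqModerateGrowth_of_le (hn : u.IsNormalized) {A B : ℝ} (hB : 0 ≤ B)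
    (h : ∀ j k, u.assocSeq (j + k) ≤ A * B ^ (j + k) * (u.assocSeq j * u.assocSeq k)) :
    SeqModerateGrowth u.assocSeq := by
  have hA : 1 ≤ max A 1 := le_max_right _ _
  have hB1 : 1 ≤ max B 1 := le_max_right _ _
  refine ⟨max A 1 * max B 1, one_le_mul_of_one_le_of_one_le hA hB1, fun j k => ?_⟩
  have hM : ∀ j, 0 ≤ u.assocSeq j := fun j => zero_le_one.trans (hn.one_le_assocSeq j)
  -- The constant is absorbed by `A ≤ max A 1 ^ (j + k)`, which needs `j + k > 0`; for `j = k = 0`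
  -- one uses `M_0 = 1`.
  rcases Nat.eq_zero_or_pos (j + k) with h0 | h0
  · obtain ⟨rfl, rfl⟩ := Nat.add_eq_zero_iff.mp h0
    simp [hn.assocSeq_zero]
  refine (h j k).trans (mul_le_mul_of_nonneg_right ?_ (mul_nonneg (hM j) (hM k)))
  rw [mul_pow]
  exact mul_le_mul ((le_max_left _ _).trans (le_self_pow₀ hA h0.ne'))
    (pow_le_pow_left₀ hB (le_max_left _ _) _) (by positivity) (by positivity)

theorem IsModerateGrowth.assocSeq (hn : u.IsNormalized) (h : u.IsModerateGrowth) :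
    SeqModerateGrowth u.assocSeq := by
  obtain ⟨H, hH, h⟩ := h
  refine hn.seqModerateGrowth_of_le (A := Real.exp H) H.coe_nonneg fun j k => ?_
  refine u.assocSeq_le fun x hx => ?_
  set t := x / H
  have hxt : x = H * t := (mul_div_cancel₀ x (by positivity)).symm
  have h1 := mul_le_mul (u.pow_mul_le_assocSeq j t) (u.pow_mul_le_assocSeq k t)
    (by have := u.pos' t; positivity) (zero_le_one.trans (hn.one_le_assocSeq j))
  rw [hxt, NNReal.coe_mul, mul_pow]
  calc (H : ℝ) ^ (j + k) * t ^ (j + k) * u (H * t)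
      ≤ H ^ (j + k) * t ^ (j + k) * (Real.exp H * u t ^ 2) :=
        mul_le_mul_of_nonneg_left (h t) (by positivity)
    _ = Real.exp H * H ^ (j + k) * (t ^ j * u t * (t ^ k * u t)) := by ring
    _ ≤ Real.exp H * H ^ (j + k) * (u.assocSeq j * u.assocSeq k) :=
        mul_le_mul_of_nonneg_left h1 (by positivity)

end Weight

theorem mem_HInf {v : Weight} {f : Entire} {A : ℝ} (h : ∀ z, ‖f z‖ * v ‖z‖₊ ≤ A) : f ∈ HInf v :=
  ⟨A, by rintro _ ⟨z, rfl⟩; exact h z⟩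

/-! ### The inductive limit topology -/

section FinestTopology

open scoped Pointwise

variable {ι E : Type*} [AddCommGroup E] [Module ℂ E] {F : ι → Type*}
  [∀ i, NormedAddCommGroup (F i)] [∀ i, NormedSpace ℂ (F i)]

/-- In a locally convex inductive limit of normed spaces, a convex balanced set is a neighbourhood
of zero as soon as it contains the image of a ball of each step. -/
theorem mem_nhds_zero_of_finest [tE : TopologicalSpace E] (T : ∀ i, F i →ₗ[ℂ] E)
    (hfin : ∀ t : TopologicalSpace E, @IsTopologicalAddGroup E t _ → @ContinuousSMul ℂ E _ _ t →
      @LocallyConvexSpace ℝ E _ _ _ _ t → (∀ i, @Continuous (F i) E _ t (T i)) → tE ≤ t)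
    (hsurj : ∀ x, ∃ i f, T i f = x) {U : Set E} (hconv : Convex ℝ U) (hbal : Balanced ℂ U)
    (h : ∀ i, ∃ ε > 0, ∀ f : F i, ‖f‖ ≤ ε → T i f ∈ U) : U ∈ nhds 0 := by
  have hstep : ∀ i, ∃ C, 0 < C ∧ ∀ f : F i, ∀ r : ℝ, C * ‖f‖ ≤ r → 0 < r → T i f ∈ r • U :=
    fun i => by
    obtain ⟨ε, hε, hi⟩ := h i
    refine ⟨ε⁻¹, inv_pos.mpr hε, fun f r hr hr0 => ?_⟩
    rw [Set.mem_smul_set_iff_inv_smul_mem₀ hr0.ne']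
    have := hi (((r⁻¹ : ℝ) : ℂ) • f) (by
      rw [norm_smul, Complex.norm_real, norm_inv, Real.norm_of_nonneg hr0.le,
        inv_mul_le_iff₀ hr0]
      rwa [inv_mul_le_iff₀ hε, mul_comm] at hr)
    rwa [map_smul, Complex.coe_smul] at this
  have hbalR : Balanced ℝ U := fun a ha => by
    rintro _ ⟨x, hx, rfl⟩
    have h1 := hbal (a : ℂ) (by simpa using ha) ⟨x, hx, rfl⟩
    simpa only [Complex.coe_smul] using h1
  have habs : Absorbent ℝ U := fun x => by
    obtain ⟨i, f, rfl⟩ := hsurj x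
    obtain ⟨C, hC, hi⟩ := hstep i
    refine Absorbs.of_norm ⟨max 1 (C * ‖f‖), fun c hc => ?_⟩
    have hc0 : 0 < ‖c‖ := one_pos.trans_le ((le_max_left _ _).trans hc)
    rw [Set.singleton_subset_iff]
    exact hbalR.smul_mono (a := ‖c‖) (b := c) (by simp)
      (hi f ‖c‖ ((le_max_right _ _).trans hc) hc0)
  -- The gauge of `U` defines a locally convex topology in which all `T i` are continuous, hence one
  -- coarser than `tE`; its open unit ball is contained in `U`.
  let p : Seminorm ℂ E := gaugeSeminorm hbal hconv habs
  let P : SeminormFamily ℂ E Unit := fun _ => p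
  let t : TopologicalSpace E := P.moduleFilterBasis.topology
  have hP : @WithSeminorms _ _ _ _ _ _ P t := @WithSeminorms.mk _ _ _ _ _ _ P t rfl
  have hle : tE ≤ t := by
    refine hfin t hP.topologicalAddGroup hP.continuousSMul hP.toLocallyConvexSpace fun i => ?_
    obtain ⟨C, hC, hi⟩ := hstep i
    refine WithSeminorms.continuous_normedSpace_dom (F i) hP (T i)
      fun _ => ⟨C.toNNReal, fun f => ?_⟩
    change gauge U (T i f) ≤ C.toNNReal * ‖f‖
    rw [Real.coe_toNNReal _ hC.le]
    refine le_of_forall_pos_le_add fun δ hδ => gauge_le_of_mem (by positivity) ?_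
    exact hi f _ (by linarith) (by positivity)
  have hnhds : U ∈ @nhds _ t 0 := by
    have hc : @Continuous _ _ t _ (p : E → ℝ) := hP.continuous_seminorm ()
    have ho : @IsOpen _ t (p ⁻¹' Set.Iio 1) := @IsOpen.preimage _ _ t _ _ hc _ isOpen_Iio
    have h0 : (0 : E) ∈ (p : E → ℝ) ⁻¹' Set.Iio 1 := by simp
    have hsub : (p : E → ℝ) ⁻¹' Set.Iio 1 ⊆ U := fun x hx =>
      setOfPred_gauge_lt_one_subset_self hconv habs.zero_mem habs hx
    exact (@mem_nhds_iff E t 0 U).mpr ⟨(p : E → ℝ) ⁻¹' Set.Iio 1, hsub, ho, h0⟩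
  exact nhds_mono hle hnhds

/-- Multiplication by a complex scalar is real-linear, so it commutes with taking real convex hulls.
-/
theorem balanced_convexHull {s : Set E} (hs : Balanced ℂ s) : Balanced ℂ (convexHull ℝ s) := by
  intro a ha
  rintro _ ⟨x, hx, rfl⟩
  have h1 := Set.mem_image_of_mem (a • (LinearMap.id : E →ₗ[ℂ] E)).toFun hx
  have h2 := ((a • (LinearMap.id : E →ₗ[ℂ] E)).restrictScalars ℝ).image_convexHull s
  have h3 : a • x ∈ ((a • (LinearMap.id : E →ₗ[ℂ] E)).restrictScalars ℝ) '' convexHull ℝ s :=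
    ⟨x, hx, rfl⟩
  rw [h2] at h3
  refine convexHull_mono ?_ h3
  rintro _ ⟨y, hy, rfl⟩
  exact hs a ha ⟨y, hy, rfl⟩

/-- A bilinear map on a locally convex inductive limit of normed spaces is continuous as
soon as it maps the product of the unit balls of the steps `m ≤ n` into a multiple of the unit
ball of some step depending only on `n`. -/
theorem continuous_bilinear_of_finest [LinearOrder ι] [tE : TopologicalSpace E] [IsTopologicalAddGroup E] [ContinuousSMul ℂ E]
    [LocallyConvexSpace ℝ E] (T : ∀ i, F i →ₗ[ℂ] E) (hT : ∀ i, Continuous (T i))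
    (hfin : ∀ t : TopologicalSpace E, @IsTopologicalAddGroup E t _ → @ContinuousSMul ℂ E _ _ t →
      @LocallyConvexSpace ℝ E _ _ _ _ t → (∀ i, @Continuous (F i) E _ t (T i)) → tE ≤ t)
    (hsurj : ∀ x, ∃ i f, T i f = x) (B : E →ₗ[ℂ] E →ₗ[ℂ] E) (hsymm : ∀ x y, B x y = B y x)
    (σ : ι → ι) (K : ℝ)
    (hB : ∀ m n, m ≤ n → ∀ (f : F m) (g : F n), ∃ k : F (σ n),
      T (σ n) k = B (T m f) (T n g) ∧ ‖k‖ ≤ K * (‖f‖ * ‖g‖)) :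
    Continuous fun p : E × E => B p.1 p.2 := by
  have key : ∀ W ∈ nhds (0 : E), ∃ U ∈ nhds (0 : E), ∀ x ∈ U, ∀ y ∈ U, B x y ∈ W := by
    intro W hW
    obtain ⟨W', ⟨hW', hWc⟩, hWW⟩ := (LocallyConvexSpace.convex_basis_zero ℝ E).mem_iff.mp hW
    have hδ : ∀ n, ∃ δ > 0, ∀ f : F n, ‖f‖ ≤ δ → T n f ∈ W' := fun n => by
      have h1 : T n ⁻¹' W' ∈ nhds 0 := (hT n).continuousAt.preimage_mem_nhds (by simpa using hW')
      obtain ⟨δ, hδ, h⟩ := Metric.nhds_basis_closedBall.mem_iff.mp h1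
      exact ⟨δ, hδ, fun f hf => h (by simpa using hf)⟩
    choose δ hδ0 hδ using hδ
    set K' := max K 1
    have hK' : 0 < K' := one_pos.trans_le (le_max_right _ _)
    -- For a pair of steps `m ≤ n` the product is estimated in step `σ n`. The factor from step `n`
    -- supplies the whole smallness `δ (σ n) / K'`, while the one from step `m` only needs norm at
    -- most `1`. Thus each radius depends on its own index alone.
    set ε : ι → ℝ := fun n => min 1 (δ (σ n) / K')
    have hε0 : ∀ n, 0 < ε n := fun n => lt_min one_pos (div_pos (hδ0 _) hK')
    set S : Set E := ⋃ n, T n '' {f | ‖f‖ ≤ ε n}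
    have hS : Balanced ℂ S := by
      refine balanced_iUnion fun n a ha => ?_
      rintro _ ⟨_, ⟨f, hf, rfl⟩, rfl⟩
      refine ⟨a • f, ?_, map_smul _ _ _⟩
      rw [Set.mem_ofPred_eq, norm_smul]
      exact (mul_le_of_le_one_left (norm_nonneg f) ha).trans hf
    have hle : ∀ m n, m ≤ n → ∀ f : F m, ∀ g : F n, ‖f‖ ≤ ε m → ‖g‖ ≤ ε n →
        B (T m f) (T n g) ∈ W' := fun m n hmn f g hf hg => by
      obtain ⟨k, hk, hkn⟩ := hB m n hmn f g
      rw [← hk]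
      refine hδ _ k (hkn.trans ?_)
      calc K * (‖f‖ * ‖g‖) ≤ K' * (1 * (δ (σ n) / K')) := by
            refine mul_le_mul (le_max_left _ _) (mul_le_mul (hf.trans (min_le_left _ _))
              (hg.trans (min_le_right _ _)) (norm_nonneg _) zero_le_one) (by positivity) hK'.le
        _ = δ (σ n) := by field_simp
    have hSS : ∀ x ∈ S, ∀ y ∈ S, B x y ∈ W' := by
      intro x hx y hy
      obtain ⟨m, f, hf, rfl⟩ := Set.mem_iUnion.mp hx
      obtain ⟨n, g, hg, rfl⟩ := Set.mem_iUnion.mp hy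
      rcases le_total m n with h | h
      · exact hle m n h f g hf hg
      · rw [hsymm]; exact hle n m h g f hg hf
    -- As `W'` is convex and `B` is linear in each variable, the inclusion passes from `S` to its
    -- convex hull one variable at a time.
    have hSc : ∀ x ∈ S, ∀ y ∈ convexHull ℝ S, B x y ∈ W' := fun x hx =>
      convexHull_min (hSS x hx) (hWc.linear_preimage ((B x).restrictScalars ℝ))
    have hcc : ∀ x ∈ convexHull ℝ S, ∀ y ∈ convexHull ℝ S, B x y ∈ W' := fun x hx y hy =>
      convexHull_min (t := {x | B x y ∈ W'}) (fun x hx => hSc x hx y hy)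
        (hWc.linear_preimage ((B.flip y).restrictScalars ℝ)) hx
    refine ⟨convexHull ℝ S, mem_nhds_zero_of_finest T hfin hsurj (convex_convexHull ℝ S)
      (balanced_convexHull hS) fun n => ⟨ε n, hε0 n, fun f hf => subset_convexHull ℝ S ?_⟩,
      fun x hx y hy => hWW (hcc x hx y hy)⟩
    exact Set.mem_iUnion.mpr ⟨n, f, hf, rfl⟩
  -- Separate continuity follows from `key` by rescaling: `B x y = B (c x) (c⁻¹ y)` with `c ≠ 0` so
  -- small that `c x ∈ U`.
  have hsep : ∀ x, ContinuousAt (B x) 0 := fun x => by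
    rw [ContinuousAt, map_zero]
    intro W hW
    obtain ⟨U, hU, h⟩ := key W hW
    obtain ⟨c, hc, hcx⟩ : ∃ c : ℂ, c ≠ 0 ∧ c • x ∈ U := by
      have h1 : Filter.Tendsto (fun c : ℂ => c • x) (nhds 0) (nhds 0) := by
        have : Continuous fun c : ℂ => c • x := by fun_prop
        simpa using this.tendsto 0
      have h2 := (h1.eventually_mem hU).filter_mono (nhdsWithin_le_nhds (s := {0}ᶜ))
      obtain ⟨c, hc, hc'⟩ := (h2.and self_mem_nhdsWithin).exists
      exact ⟨c, hc', hc⟩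
    have h1 : Filter.Tendsto (fun y : E => c⁻¹ • y) (nhds 0) (nhds 0) := by
      have : Continuous fun y : E => c⁻¹ • y := by fun_prop
      simpa using this.tendsto 0
    refine Filter.mem_map.mpr (Filter.mem_of_superset (h1 hU) fun y hy => ?_)
    have := h _ hcx _ hy
    rwa [map_smul, map_smul, LinearMap.smul_apply, smul_smul, inv_mul_cancel₀ hc, one_smul] at this
  refine continuous_of_continuousAt_zero₂
    ((LinearMap.toAddMonoidHom' : (E →ₗ[ℂ] E) →+ E →+ E).comp B.toAddMonoidHom)
    ?_ (fun x => hsep x) fun y => ?_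
  · rw [ContinuousAt, Prod.mk_zero_zero, Prod.fst_zero, map_zero, ← Prod.mk_zero_zero,
      nhds_prod_eq]
    intro W hW
    obtain ⟨U, hU, h⟩ := key W (by simpa using hW)
    exact Filter.mem_map.mpr (Filter.mem_of_superset (Filter.prod_mem_prod hU hU)
      fun p hp => h _ hp.1 _ hp.2)
  · convert hsep y using 2 with x
    exact hsymm _ _

end FinestTopology

section IndLim

variable {V : ℕ+ → Weight}

instance : IsTopologicalAddGroup (indLim V) := topologicalAddGroup_sInf fun _ ht => ht.1

instance : ContinuousSMul ℂ (indLim V) := continuousSMul_sInf fun _ ht => ht.2.1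

instance : LocallyConvexSpace ℝ (indLim V) := LocallyConvexSpace.sInf fun _ ht => ht.2.2.1

theorem continuous_toIndLim (n : ℕ+) : Continuous (toIndLim V n) :=
  continuous_sInf_rng.mpr fun _ ht => ht.2.2.2 n

end IndLim

/-! ### Moderate growth implies continuity of multiplication -/

section

variable {u : Weight}

theorem Weight.IsModerateGrowth.exists_nat (h : u.IsModerateGrowth) :
    ∃ (N : ℕ+) (K : ℝ), 0 ≤ K ∧ ∀ t : ℝ≥0, u ((N : ℕ) * t) ≤ K * u t ^ 2 := by
  obtain ⟨H, hH, h⟩ := h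
  have hN : 0 < ⌈H⌉₊ := Nat.ceil_pos.mpr (one_pos.trans_le hH)
  exact ⟨⟨⌈H⌉₊, hN⟩, Real.exp H, (Real.exp_pos _).le, fun t =>
    (u.antitone' (mul_le_mul_left (Nat.le_ceil H) t)).trans (h t)⟩

/-- The product of functions in weighted spaces. -/
theorem mul_mem_HInf {v w : Weight} {K : ℝ} (hK : 0 ≤ K) (h : ∀ t, v t ≤ K * w t ^ 2)
    {f g : Entire} (hf : f ∈ HInf w) (hg : g ∈ HInf w) :
    ∃ hfg : f * g ∈ HInf v, ‖(⟨f * g, hfg⟩ : HInf v)‖ ≤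
      K * (‖(⟨f, hf⟩ : HInf w)‖ * ‖(⟨g, hg⟩ : HInf w)‖) := by
  have key : ∀ z, ‖(f * g) z‖ * v ‖z‖₊ ≤
      K * (‖(⟨f, hf⟩ : HInf w)‖ * ‖(⟨g, hg⟩ : HInf w)‖) := fun z => by
    have h1 := HInf.le_norm (⟨f, hf⟩ : HInf w) z
    have h2 := HInf.le_norm (⟨g, hg⟩ : HInf w) z
    have hw := w.pos' ‖z‖₊
    calc ‖(f * g) z‖ * v ‖z‖₊ ≤ ‖(f * g) z‖ * (K * w ‖z‖₊ ^ 2) :=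
          mul_le_mul_of_nonneg_left (h _) (norm_nonneg _)
      _ = K * ((‖f z‖ * w ‖z‖₊) * (‖g z‖ * w ‖z‖₊)) := by
          rw [Entire.mul_apply, norm_mul]; ring
      _ ≤ _ := mul_le_mul_of_nonneg_left
          (mul_le_mul h1 h2 (by positivity) (norm_nonneg _)) hK
  exact ⟨mem_HInf key, ciSup_le key⟩

theorem norm_inclusion_le {v w : Weight} (h : w ≤ v) (f : HInf v) :
    ‖(⟨f.1, HInf_mono h f.2⟩ : HInf w)‖ ≤ ‖f‖ :=
  ciSup_le fun z => (mul_le_mul_of_nonneg_left (h _) (norm_nonneg _)).trans (HInf.le_norm f z)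

/-- Multiplication on an algebra of entire functions, as a bilinear map. -/
def mulBilin (E : Submodule ℂ Entire) (hE : ∀ f ∈ E, ∀ g ∈ E, f * g ∈ E) : E →ₗ[ℂ] E →ₗ[ℂ] E :=
  LinearMap.mk₂ ℂ (fun f g => ⟨f.1 * g.1, hE f.1 f.2 g.1 g.2⟩)
    (fun _ _ _ => Subtype.ext (add_mul _ _ _)) (fun _ _ _ => Subtype.ext (smul_mul_assoc _ _ _))
    (fun _ _ _ => Subtype.ext (mul_add _ _ _)) (fun _ _ _ => Subtype.ext (mul_smul_comm _ _ _))

theorem Weight.IsModerateGrowth.mulActsContinuously_indLim (h : u.IsModerateGrowth) :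
    MulActsContinuously (indLim u.lowerSystem) := by
  obtain ⟨N, K, hK, h⟩ := h.exists_nat
  have hV := u.lowerSystem_antitone
  have hw : ∀ n t, u.lowerSystem (N * n) t ≤ K * u.lowerSystem n t ^ 2 := fun n t => by
    have := h ((n : ℕ) * t)
    rw [← mul_assoc, ← Nat.cast_mul, ← PNat.mul_coe] at this
    exact this
  have hB : ∀ m n, m ≤ n → ∀ (f : HInf (u.lowerSystem m)) (g : HInf (u.lowerSystem n)),
      ∃ k : HInf (u.lowerSystem (N * n)), k.1 = f.1 * g.1 ∧ ‖k‖ ≤ K * (‖f‖ * ‖g‖) := by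
    intro m n hmn f g
    obtain ⟨hfg, hle⟩ := mul_mem_HInf hK (hw n) (HInf_mono (hV m n hmn) f.2) g.2
    refine ⟨⟨_, hfg⟩, rfl, hle.trans (mul_le_mul_of_nonneg_left ?_ hK)⟩
    exact mul_le_mul_of_nonneg_right (norm_inclusion_le (hV m n hmn) f) (norm_nonneg _)
  have hE : ∀ f ∈ indLim u.lowerSystem, ∀ g ∈ indLim u.lowerSystem,
      f * g ∈ indLim u.lowerSystem := fun f hf g hg => by
    obtain ⟨m, hm⟩ := (mem_indLim hV).mp hf
    obtain ⟨n, hn⟩ := (mem_indLim hV).mp hg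
    obtain ⟨k, hk, -⟩ := hB _ _ le_rfl ⟨f, HInf_mono (hV _ _ (le_max_left m n)) hm⟩
      ⟨g, HInf_mono (hV _ _ (le_max_right m n)) hn⟩
    exact (mem_indLim hV).mpr ⟨_, hk ▸ k.2⟩
  refine ⟨hE, ?_⟩
  refine continuous_bilinear_of_finest (toIndLim u.lowerSystem) continuous_toIndLim
    (fun t h1 h2 h3 h4 => sInf_le ⟨h1, h2, h3, h4⟩) (fun f => ?_) (mulBilin _ hE)
    (fun f g => Subtype.ext (mul_comm _ _)) (fun n => N * n) K fun m n hmn f g => ?_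
  · obtain ⟨n, hn⟩ := (mem_indLim hV).mp f.2
    exact ⟨n, ⟨f.1, hn⟩, rfl⟩
  · obtain ⟨k, hk, hle⟩ := hB m n hmn f g
    exact ⟨k, Subtype.ext hk, hle⟩

theorem continuous_ofProjLim {V : ℕ+ → Weight} (n : ℕ+) : Continuous (ofProjLim V n) :=
  continuous_iInf_dom continuous_induced_dom

theorem Weight.IsModerateGrowth.mulActsContinuously_projLim (h : u.IsModerateGrowth) :
    MulActsContinuously (projLim u.upperSystem) := by
  obtain ⟨N, K, hK, h⟩ := h.exists_nat
  -- Moderate growth is applied at the point `t / (N n)`.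
  have hw : ∀ n t, u.upperSystem n t ≤ K * u.upperSystem (N * n) t ^ 2 := fun n t => by
    have := h (1 / ((N * n : ℕ+) : ℕ) * t)
    have h1 : ((N : ℕ) : ℝ≥0) * (1 / ((N * n : ℕ+) : ℕ) * t) = 1 / (n : ℕ) * t := by
      have : ((N : ℕ) : ℝ≥0) ≠ 0 := by exact_mod_cast N.ne_zero
      have : ((n : ℕ) : ℝ≥0) ≠ 0 := by exact_mod_cast n.ne_zero
      push_cast
      field_simp
    rw [h1] at this
    exact this
  have hE : ∀ f ∈ projLim u.upperSystem, ∀ g ∈ projLim u.upperSystem,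
      f * g ∈ projLim u.upperSystem := fun f hf g hg => mem_projLim.mpr fun n =>
    (mul_mem_HInf hK (hw n) (mem_projLim.mp hf (N * n)) (mem_projLim.mp hg (N * n))).1
  refine ⟨hE, continuous_iInf_rng.mpr fun n => continuous_induced_rng.mpr ?_⟩
  have hm := fun f g : HInf (u.upperSystem (N * n)) => mul_mem_HInf hK (hw n) f.2 g.2
  let B : HInf (u.upperSystem (N * n)) →ₗ[ℂ] HInf (u.upperSystem (N * n)) →ₗ[ℂ]
      HInf (u.upperSystem n) :=
    LinearMap.mk₂ ℂ (fun f g => ⟨f.1 * g.1, (hm f g).1⟩)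
    (fun _ _ _ => Subtype.ext (add_mul _ _ _)) (fun _ _ _ => Subtype.ext (smul_mul_assoc _ _ _))
    (fun _ _ _ => Subtype.ext (mul_add _ _ _)) (fun _ _ _ => Subtype.ext (mul_smul_comm _ _ _))
  -- Composed with the inclusion into step `n`, multiplication factors through the bounded bilinear
  -- map from step `N * n` to step `n`.
  let B' := B.mkContinuous₂ K fun f g => (hm f g).2.trans_eq (mul_assoc _ _ _).symm
  have hc : Continuous fun p : HInf (u.upperSystem (N * n)) × HInf (u.upperSystem (N * n)) =>
      B' p.1 p.2 := B'.continuous₂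
  exact hc.comp ((continuous_ofProjLim (N * n)).prodMap (continuous_ofProjLim (N * n)))

end

section

variable {u : Weight}

/-! ### A test function for the inductive limit -/

theorem norm_testTerm_le (hn : u.IsNormalized) (j : ℕ) (z : ℂ) :
    ‖z ^ j / (2 ^ j * u.assocSeq j : ℝ)‖ ≤ (1 / 2) ^ j * (u ‖z‖₊)⁻¹ := by
  have hM := one_pos.trans_le (hn.one_le_assocSeq j)
  have hu := u.pos' ‖z‖₊
  have h := u.pow_mul_le_assocSeq j ‖z‖₊
  rw [coe_nnnorm] at h
  rw [norm_div, norm_pow, Complex.norm_real, Real.norm_of_nonneg (by positivity), one_div, inv_pow,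
    ← mul_inv, div_le_iff₀ (by positivity)]
  rw [← le_div_iff₀ hu] at h
  refine h.trans_eq ?_
  field_simp

/-- The entire function `z ↦ ∑ z^j / (2^j M_j)`. -/
noncomputable def testFun (u : Weight) (hn : u.IsNormalized) : Entire :=
  ⟨fun z => ∑' j : ℕ, z ^ j / (2 ^ j * u.assocSeq j : ℝ), fun z => by
    -- On the ball of radius `‖z‖ + 1`, monotonicity bounds `1/u` by its value at that radius, so
    -- the series converges normally there.
    have hsum : Summable fun j : ℕ => (1 / 2 : ℝ) ^ j * (u (‖z‖₊ + 1))⁻¹ :=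
      summable_geometric_two.mul_right _
    have h := Complex.differentiableOn_tsum_of_summable_norm hsum
      (F := fun j z => z ^ j / ((2 ^ j * u.assocSeq j : ℝ) : ℂ)) (U := Metric.ball 0 (‖z‖ + 1))
      (fun j => by fun_prop) Metric.isOpen_ball fun j w hw => by
        refine (norm_testTerm_le hn j w).trans (mul_le_mul_of_nonneg_left ?_ (by positivity))
        refine inv_anti₀ (u.pos' _) (u.antitone' (NNReal.coe_le_coe.mp ?_))
        simpa using (mem_ball_zero_iff.mp hw).le
    exact h.differentiableAt (Metric.isOpen_ball.mem_nhds (by simp))⟩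

theorem testFun_mem (hn : u.IsNormalized) : testFun u hn ∈ HInf u := by
  refine mem_HInf (A := 2) fun z => ?_
  have h := tsum_of_norm_bounded (summable_geometric_two.hasSum.mul_right (u ‖z‖₊)⁻¹)
    fun j => norm_testTerm_le hn j z
  rw [tsum_geometric_two] at h
  rwa [← div_eq_mul_inv, le_div_iff₀ (u.pos' _)] at h

/-- At the point `2t` the factors `2^j` cancel and all terms are nonnegative, so the sum dominates
each of them. -/
theorem le_norm_testFun (hn : u.IsNormalized) (j : ℕ) (t : ℝ≥0) :
    (t : ℝ) ^ j / u.assocSeq j ≤ ‖testFun u hn ((2 * t : ℝ≥0) : ℝ)‖ := by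
  have hM := fun j => one_pos.trans_le (hn.one_le_assocSeq j)
  have hterm : ∀ j : ℕ, ((((2 * t : ℝ≥0) : ℝ) : ℂ) ^ j / (2 ^ j * u.assocSeq j : ℝ)) =
      ((t ^ j / u.assocSeq j : ℝ) : ℂ) := fun j => by
    have h2 : (u.assocSeq j : ℂ) ≠ 0 := by exact_mod_cast (hM j).ne'
    push_cast
    rw [mul_pow]
    field_simp
  have hnn : ∀ j : ℕ, 0 ≤ (t : ℝ) ^ j / u.assocSeq j := fun j => by have := hM j; positivity
  have hsum : Summable fun j : ℕ => (t : ℝ) ^ j / u.assocSeq j := by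
    refine Summable.of_nonneg_of_le hnn (fun j => ?_)
      (summable_geometric_two.mul_right (u ‖(((2 * t : ℝ≥0) : ℝ) : ℂ)‖₊)⁻¹)
    have := norm_testTerm_le hn j ((2 * t : ℝ≥0) : ℝ)
    rwa [hterm, Complex.norm_real, Real.norm_of_nonneg (hnn j)] at this
  have hval : testFun u hn ((2 * t : ℝ≥0) : ℝ) =
      ((∑' j : ℕ, (t : ℝ) ^ j / u.assocSeq j : ℝ) : ℂ) := by
    rw [Complex.ofReal_tsum]
    exact tsum_congr hterm
  rw [hval, Complex.norm_real, Real.norm_of_nonneg (tsum_nonneg hnn)]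
  exact hsum.le_tsum j fun k _ => hnn k

theorem isModerateGrowth_of_indLim (hn : u.IsNormalized) (hc : u.IsConvex)
    (h : MulActsContinuously (indLim u.lowerSystem)) : u.IsModerateGrowth := by
  have hV := u.lowerSystem_antitone
  have hmem : testFun u hn ∈ indLim u.lowerSystem := (mem_indLim hV).mpr
    ⟨1, HInf_mono (fun t => (by simp [Weight.lowerSystem, Weight.dilate])) (testFun_mem hn)⟩
  obtain ⟨n, A, hA⟩ := (mem_indLim hV).mp (h.1 _ hmem _ hmem)
  refine hn.isModerateGrowth_of_le ((n : ℕ) * 2) A fun t ht => ?_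
  have ht0 : (0 : ℝ) < t := by exact_mod_cast one_pos.trans_le ht
  obtain ⟨j, hj⟩ := hc.exists_assocSeq_le hn ht
  have hu := u.pos' t
  have hM := one_pos.trans_le (hn.one_le_assocSeq j)
  -- The index `j` adapted to `t` makes the test function almost as large as `1/u(t)`; its square is
  -- then compared with the bound `A` in step `n`.
  have h1 : (t * u t)⁻¹ ≤ ‖testFun u hn ((2 * t : ℝ≥0) : ℝ)‖ := by
    refine le_trans ?_ (le_norm_testFun hn j t)
    rw [le_div_iff₀ hM, inv_mul_le_iff₀ (by positivity)]
    exact hj.trans_eq (by ring)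
  have h2 : ‖(testFun u hn * testFun u hn) ((2 * t : ℝ≥0) : ℝ)‖ *
      u ((n : ℕ) * ‖(((2 * t : ℝ≥0) : ℝ) : ℂ)‖₊) ≤ A := hA ⟨_, rfl⟩
  have h3 : ‖(((2 * t : ℝ≥0) : ℝ) : ℂ)‖₊ = 2 * t := by ext; simp
  rw [h3, Entire.mul_apply, norm_mul, ← mul_assoc] at h2
  have h4 := mul_le_mul h1 h1 (by positivity) (norm_nonneg _)
  have h5 := (mul_le_mul_of_nonneg_right h4 (u.pos' ((n : ℕ) * 2 * t)).le).trans h2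
  rw [← mul_inv, inv_mul_le_iff₀ (by positivity)] at h5
  exact h5.trans_eq (by ring)

/-! ### Monomials and the projective limit -/

/-- The monomial `z ↦ z^j` as an entire function. -/
def monomial (j : ℕ) : Entire := ⟨fun z => z ^ j, differentiable_pow j⟩

theorem norm_monomial_mul_le (u : Weight) (m : ℕ+) (j : ℕ) (z : ℂ) :
    ‖monomial j z‖ * u.upperSystem m ‖z‖₊ ≤ (m : ℕ) ^ j * u.assocSeq j := by
  have hm : ((m : ℕ) : ℝ) ≠ 0 := by exact_mod_cast m.ne_zero
  have h := mul_le_mul_of_nonneg_left (u.pow_mul_le_assocSeq j (1 / (m : ℕ) * ‖z‖₊))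
    (pow_nonneg (Nat.cast_nonneg (m : ℕ)) j)
  refine le_trans (le_of_eq ?_) h
  change ‖z ^ j‖ * u (1 / (m : ℕ) * ‖z‖₊) = _
  rw [norm_pow]
  push_cast
  rw [← mul_assoc, ← mul_pow]
  congr 2
  field_simp

theorem monomial_mem (u : Weight) (j : ℕ) : monomial j ∈ projLim u.upperSystem :=
  mem_projLim.mpr fun m => mem_HInf (norm_monomial_mul_le u m j)

theorem Weight.upperSystem_monotone (v : Weight) (m n : ℕ+) (h : m ≤ n) :
    v.upperSystem m ≤ v.upperSystem n := fun t => by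
  refine v.antitone' (mul_le_mul_left (one_div_le_one_div_of_le ?_ ?_) t)
  · exact_mod_cast m.pos
  · exact_mod_cast h

/-- The balls of the steps form a basis of neighbourhoods of zero in the projective limit of a
non-decreasing system. -/
theorem exists_norm_le_of_mem_nhds_projLim {V : ℕ+ → Weight} (hV : ∀ m n, m ≤ n → V m ≤ V n)
    {W : Set (projLim V)} (hW : W ∈ nhds 0) :
    ∃ (m : ℕ+) (ε : ℝ), 0 < ε ∧ ∀ f, ‖ofProjLim V m f‖ ≤ ε → f ∈ W := by
  have hnhds : nhds (0 : projLim V) = ⨅ n, Filter.comap (ofProjLim V n) (nhds 0) := by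
    refine nhds_iInf.trans (iInf_congr fun n => ?_)
    rw [nhds_induced, map_zero]
  -- The inclusions between steps are norm-decreasing, so the pulled-back filters form a directed
  -- family and a single step suffices for each neighbourhood.
  have hanti : ∀ m n, m ≤ n → Filter.comap (ofProjLim V n) (nhds 0) ≤
      Filter.comap (ofProjLim V m) (nhds 0) := fun m n hmn => by
    let J : HInf (V n) →L[ℂ] HInf (V m) :=
      (Submodule.inclusion (HInf_mono (hV m n hmn))).mkContinuous 1 fun f => by
        rw [one_mul]; exact norm_inclusion_le (hV m n hmn) f
    have hJ : (ofProjLim V m : projLim V → HInf (V m)) = J ∘ ofProjLim V n := rfl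
    rw [hJ, ← Filter.comap_comap]
    refine Filter.comap_mono (Filter.map_le_iff_le_comap.mp ?_)
    exact (J.continuous.tendsto 0).mono_right (by rw [map_zero])
  rw [hnhds, Filter.mem_iInf_of_directed
    (directed_of_isDirected_le (r := (· ≥ ·)) fun m n hmn => hanti m n hmn)] at hW
  obtain ⟨m, s, hs, hsW⟩ := hW
  obtain ⟨ε, hε, h⟩ := Metric.nhds_basis_closedBall.mem_iff.mp hs
  exact ⟨m, ε, hε, fun f hf => hsW (h (by simpa using hf))⟩

theorem seqModerateGrowth_of_projLim (hn : u.IsNormalized)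
    (h : MulActsContinuously (projLim u.upperSystem)) : SeqModerateGrowth u.assocSeq := by
  obtain ⟨hE, hcont⟩ := h
  have hc := ((continuous_ofProjLim 1).comp hcont).tendsto (0, 0)
  have hW : {p : projLim u.upperSystem × projLim u.upperSystem |
      ‖ofProjLim u.upperSystem 1 ⟨p.1.1 * p.2.1, hE _ p.1.2 _ p.2.2⟩‖ < 1} ∈ nhds (0, 0) := by
    refine (hc.norm).eventually_lt_const ?_
    have h0 : (⟨(0 : projLim u.upperSystem).1 * (0 : projLim u.upperSystem).1,
        hE _ (Submodule.zero_mem _) _ (Submodule.zero_mem _)⟩ : projLim u.upperSystem) = 0 :=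
      Subtype.ext (mul_zero _)
    simp only [Function.comp_apply]
    rw [h0, map_zero, norm_zero]
    exact one_pos
  rw [nhds_prod_eq, Filter.mem_prod_same_iff] at hW
  obtain ⟨S, hS, hSW⟩ := hW
  obtain ⟨m, ε, hε, hm⟩ := exists_norm_le_of_mem_nhds_projLim u.upperSystem_monotone hS
  have hM := fun j => one_pos.trans_le (hn.one_le_assocSeq j)
  have hm0 : (0 : ℝ) < (m : ℕ) := by exact_mod_cast m.pos
  -- The monomial `z^j` has norm at most `m^j M_j` in step `m`, so `a j • z^j` lies in the ball of
  -- radius `ε`. That products from `S` have norm below `1` in `H^∞_u` then gives `t^(j+k) u(t) ≤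
  -- 1/(a j * a k) = ε⁻² m^(j+k) M_j M_k`.
  set a : ℕ → ℝ := fun j => ε / ((m : ℕ) ^ j * u.assocSeq j)
  have ha : ∀ j, 0 < a j := fun j => by have := hM j; positivity
  let P : ℕ → projLim u.upperSystem := fun j => ⟨monomial j, monomial_mem u j⟩
  have hP : ∀ j, (a j : ℂ) • P j ∈ S := fun j => by
    refine hm _ ?_
    rw [map_smul, norm_smul, Complex.norm_real, Real.norm_of_nonneg (ha j).le]
    have h1 : ‖ofProjLim u.upperSystem m (P j)‖ ≤ (m : ℕ) ^ j * u.assocSeq j :=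
      ciSup_le (norm_monomial_mul_le u m j)
    refine (mul_le_mul_of_nonneg_left h1 (ha j).le).trans_eq ?_
    have := (hM j).ne'
    simp only [a]
    field_simp
  refine hn.seqModerateGrowth_of_le (A := (ε ^ 2)⁻¹) hm0.le fun j k => u.assocSeq_le fun t _ => ?_
  have h1 := hSW (Set.mk_mem_prod (hP j) (hP k))
  have h2 := (HInf.le_norm _ ((t : ℝ) : ℂ)).trans (le_of_lt h1)
  have h3 : ‖((t : ℝ) : ℂ)‖₊ = t := by ext; simp
  have h4 : u.upperSystem 1 t = u t := by simp [Weight.upperSystem, Weight.dilate]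
  rw [h3, h4] at h2
  change ‖((a j : ℂ) * ((t : ℝ) : ℂ) ^ j) * ((a k : ℂ) * ((t : ℝ) : ℂ) ^ k)‖ * u t ≤ 1 at h2
  rw [norm_mul, norm_mul, norm_mul, norm_pow, norm_pow, Complex.norm_real, Complex.norm_real,
    Complex.norm_real, Real.norm_of_nonneg (ha j).le, Real.norm_of_nonneg (ha k).le,
    Real.norm_of_nonneg t.coe_nonneg] at h2
  have h5 : (t : ℝ) ^ (j + k) * u t * (a j * a k) ≤ 1 := le_trans (le_of_eq (by ring)) h2
  rw [← le_div_iff₀ (mul_pos (ha j) (ha k))] at h5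
  refine h5.trans_eq ?_
  have := (hM j).ne'
  have := (hM k).ne'
  simp only [a]
  rw [pow_add]
  field_simp

end

end WeightedEntire

theorem mainTheorem9 (u : WeightedEntire.Weight) (hn : u.IsNormalized) (hc : u.IsConvex) :
    List.TFAE [
      WeightedEntire.MulActsContinuously (WeightedEntire.indLim u.lowerSystem),
      WeightedEntire.MulActsContinuously (WeightedEntire.projLim u.upperSystem),
      u.IsModerateGrowth,
      WeightedEntire.SeqModerateGrowth u.assocSeq] := by
  tfae_have 1 → 3 := WeightedEntire.isModerateGrowth_of_indLim hn hc
  tfae_have 3 → 1 := fun h => h.mulActsContinuously_indLim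
  tfae_have 3 → 2 := fun h => h.mulActsContinuously_projLim
  tfae_have 2 → 4 := WeightedEntire.seqModerateGrowth_of_projLim hn
  tfae_have 3 → 4 := fun h => h.assocSeq hn
  tfae_have 4 → 3 := hc.isModerateGrowth_of_assocSeq hn
  tfae_finish
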